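/- Let $\mathbb{F}_4=\{0,1,\omega,\omega^2\}$ be the field with four elements, and let $C\subset\mathbb{P}^2$ be a nonsingular plane curve of degree $3$ over $\mathbb{F}_4$, that is, the zero locus of a homogeneous cubic $f\in\mathbb{F}_4[x_0,x_1,x_2]$ such that $f$ and its partial derivatives have no common zero in $\mathbb{P}^2(\overline{\mathbb{F}_4})$. If $C$ has exactly $9$ $\mathbb{F}_4$-rational points, then exactly one of the following holds: (i) $C$ is a Hermitian curve, i.e. up to a nonzero scalar $f=\sum_{i,j=0}^{2}a_{ij}x_i^2x_j$ for an invertible matrix $(a_{ij})$ over $\mathbb{F}_4$ with $a_{ji}=a_{ij}^2$ for all $i,j$; (ii) $C$ is projectively equivalent over $\mathbb{F}_4$ to the curve $x_0^3+\omega x_1^3+\omega^2x_2^3=0$. -/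

import Mathlib

open MvPolynomial

namespace PlaneCurve

variable {K : Type*} [Field K]

/-- The projective plane curve `f = 0` is nonsingular: at no point of the projective plane over
the algebraic closure of `K` do `f` and its three partial derivatives all vanish. -/
def IsNonsingular (f : MvPolynomial (Fin 3) K) : Prop :=
  ∀ x : Fin 3 → AlgebraicClosure K, x ≠ 0 →
    ¬ (aeval x f = 0 ∧ ∀ i, aeval x (pderiv i f) = 0)

/-- The `K`-rational points of the projective plane curve `f = 0`. For homogeneous `f` the choice
of the representative is immaterial, see `mk_mem_rationalPoints`. -/
def rationalPoints (f : MvPolynomial (Fin 3) K) : Set (Projectivization K (Fin 3 → K)) :=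
  {P | eval P.rep f = 0}

theorem mk_mem_rationalPoints {f : MvPolynomial (Fin 3) K} {d : ℕ} (hf : f.IsHomogeneous d)
    (v : Fin 3 → K) (hv : v ≠ 0) :
    Projectivization.mk K v hv ∈ rationalPoints f ↔ eval v f = 0 := by
  obtain ⟨a, ha⟩ := Projectivization.exists_smul_eq_mk_rep K v hv
  have h : eval (a • v) f = (a : K) ^ d * eval v f := by
    rw [eval_eq, eval_eq, Finset.mul_sum]
    refine Finset.sum_congr rfl fun e he => ?_
    have hd : ∑ i ∈ e.support, e i = d := by
      rw [← Finsupp.degree_apply, Finsupp.degree_eq_weight_one]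
      exact hf (mem_support_iff.mp he)
    simp only [Units.smul_def, Pi.smul_apply, smul_eq_mul, mul_pow, Finset.prod_mul_distrib,
      Finset.prod_pow_eq_pow_sum, hd]
    ring
  simp [rationalPoints, ← ha, h]

/-- `f ↦ f (M x)`: the linear substitution `x_i ↦ ∑ j, M i j * x_j`. -/
noncomputable def linearSubst (M : Matrix (Fin 3) (Fin 3) K) (f : MvPolynomial (Fin 3) K) :
    MvPolynomial (Fin 3) K :=
  bind₁ (fun i => ∑ j, C (M i j) * X j) f

/-- The curves `f = 0` and `g = 0` are projectively equivalent over `K`: an invertible linear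
change of coordinates with entries in `K` takes one equation to a nonzero multiple of the other. -/
def ProjEquiv (f g : MvPolynomial (Fin 3) K) : Prop :=
  ∃ (M : Matrix.GeneralLinearGroup (Fin 3) K) (c : Kˣ),
    linearSubst (M : Matrix (Fin 3) (Fin 3) K) f = C (c : K) * g

/-- For a field `K` with `q ^ 2` elements: `f = 0` is a (nondegenerate) Hermitian curve, i.e. up to
a nonzero scalar `f` is `∑ i j, A i j * x_i ^ q * x_j` with `A` an invertible matrix that is
Hermitian for the involution `a ↦ a ^ q` of `K`. -/
def IsHermitianCurve (q : ℕ) (f : MvPolynomial (Fin 3) K) : Prop :=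
  ∃ (A : Matrix.GeneralLinearGroup (Fin 3) K) (c : Kˣ),
    (∀ i j, A.val j i = A.val i j ^ q) ∧
      f = C (c : K) * ∑ i, ∑ j, C (A.val i j) * X i ^ q * X j

end PlaneCurve

/-! ### Linear changes of coordinates -/

namespace PlaneCurve

variable {K : Type*} [Field K]

/-! A nonsingular cubic contains no line, so its set `S` of 9 rational points meets every line of
the plane of order 4 in at most 3 points (`ncard_rationalPoints_inter_line_le`). Counting then
yields two trisecants `l`, `m` of `S` that cross at a point `p` outside `S`
(`exists_trisecants_meeting_outside`). A line has 5 points, so each of `l`, `m` has exactly one more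
point off `S`, say `q` and `r`.

In the frame `p`, `q`, `r` the cubic vanishes at the points of `pq` and `pr` with both coordinates
nonzero, and not at `p`. As nonzero scalars have cube 1, it is, up to a scalar, `x³ + y³ + z³ + b
y²z + c yz² + d xyz` (`exists_linearSubst_eq`). A finite check of the 64 triples shows that 9 points
force `d = 0` and `bc = 0` (`cubic_count`). If `b = c = 0` this is the Fermat cubic, which is
Hermitian; otherwise the binary part in `y`, `z` diagonalizes to `ω u³ + ω² v³`.

The cases exclude each other because diagonal entries of a Hermitian matrix lie in the prime field,
whereas the diagonal curve has coefficient ratio `ω`. -/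

theorem aeval_linearSubst {A : Type*} [CommRing A] [Algebra K A] (M : Matrix (Fin 3) (Fin 3) K)
    (f : MvPolynomial (Fin 3) K) (v : Fin 3 → A) :
    aeval v (linearSubst M f) = aeval ((M.map (algebraMap K A)).mulVec v) f := by
  rw [linearSubst, aeval_bind₁]
  congr 2
  ext i
  simp [Matrix.mulVec, dotProduct]

theorem eval_linearSubst (M : Matrix (Fin 3) (Fin 3) K) (f : MvPolynomial (Fin 3) K)
    (v : Fin 3 → K) : eval v (linearSubst M f) = eval (M.mulVec v) f := by
  simpa [aeval_eq_eval] using aeval_linearSubst M f v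

theorem linearSubst_linearSubst (M N : Matrix (Fin 3) (Fin 3) K) (f : MvPolynomial (Fin 3) K) :
    linearSubst N (linearSubst M f) = linearSubst (M * N) f := by
  rw [linearSubst, linearSubst, bind₁_bind₁, linearSubst]
  congr 2
  ext1 i
  simp only [map_sum, map_mul, algHom_C, algebraMap_eq, bind₁_X_right, Matrix.mul_apply,
    Finset.mul_sum, Finset.sum_mul]
  rw [Finset.sum_comm]
  simp only [mul_assoc]

theorem linearSubst_one (f : MvPolynomial (Fin 3) K) : linearSubst 1 f = f := by
  have : (fun i => ∑ j, C ((1 : Matrix (Fin 3) (Fin 3) K) i j) * X j) =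
      (X : Fin 3 → MvPolynomial (Fin 3) K) := by
    ext1 i
    simp [Matrix.one_apply]
  rw [linearSubst, this, bind₁_X_left, AlgHom.id_apply]

theorem linearSubst_C_mul (M : Matrix (Fin 3) (Fin 3) K) (c : K) (f : MvPolynomial (Fin 3) K) :
    linearSubst M (C c * f) = C c * linearSubst M f := by
  simp [linearSubst]

theorem linearSubst_inv_linearSubst (M : Matrix.GeneralLinearGroup (Fin 3) K)
    (f : MvPolynomial (Fin 3) K) : linearSubst (M⁻¹).val (linearSubst M.val f) = f := by
  rw [linearSubst_linearSubst, ← Units.val_mul, mul_inv_cancel, Units.val_one, linearSubst_one]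

theorem isHomogeneous_linearSubst (M : Matrix (Fin 3) (Fin 3) K) {f : MvPolynomial (Fin 3) K}
    {d : ℕ} (hf : f.IsHomogeneous d) : (linearSubst M f).IsHomogeneous d := by
  have := hf.aeval (g := fun i => ∑ j, C (M i j) * X j) (n := 1)
    fun i => IsHomogeneous.sum _ _ _ fun j _ => isHomogeneous_C_mul_X _ _
  rwa [one_mul] at this

theorem ProjEquiv.symm {f g : MvPolynomial (Fin 3) K} (h : ProjEquiv f g) : ProjEquiv g f := by
  obtain ⟨M, c, h⟩ := h
  refine ⟨M⁻¹, c⁻¹, ?_⟩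
  have h2 := congrArg (linearSubst (M⁻¹).val) h
  rw [linearSubst_inv_linearSubst, linearSubst_C_mul] at h2
  rw [h2, ← mul_assoc, ← C_mul, Units.inv_mul, C_1, one_mul]

theorem ProjEquiv.of_linearSubst {f g : MvPolynomial (Fin 3) K}
    (M : Matrix.GeneralLinearGroup (Fin 3) K) (h : ProjEquiv (linearSubst M.val f) g) :
    ProjEquiv f g := by
  obtain ⟨N, c, h⟩ := h
  exact ⟨M * N, c, by rw [Units.val_mul, ← linearSubst_linearSubst, h]⟩

theorem linearSubst_sesquilinear {q : ℕ} (hadd : ∀ x y : MvPolynomial (Fin 3) K,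
      (x + y) ^ q = x ^ q + y ^ q) (M A : Matrix (Fin 3) (Fin 3) K) :
    linearSubst M (∑ i, ∑ j, C (A i j) * X i ^ q * X j) =
      ∑ i, ∑ j, C (((M.map (· ^ q)).transpose * A * M) i j) * X i ^ q * X j := by
  have h : ∀ i, (∑ j, C (M i j) * X j : MvPolynomial (Fin 3) K) ^ q =
      ∑ j, C (M i j ^ q) * X j ^ q := fun i => by
    simp [Fin.sum_univ_three, hadd, mul_pow]
  simp only [linearSubst, map_sum, map_mul, map_pow, bind₁_X_right, algHom_C, algebraMap_eq, h]
  simp only [Matrix.mul_apply, Fin.sum_univ_three, Matrix.transpose_apply, Matrix.map_apply,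
    map_add, map_mul, map_pow]
  ring

/-- Substitution replaces `A` by the congruent matrix `M* A M`, with `M*` the conjugate transpose;
this stays Hermitian, and its determinant is that of `A` times `det M ^ (q + 1)`. -/
theorem IsHermitianCurve.linearSubst {q : ℕ}
    (hadd : ∀ x y : MvPolynomial (Fin 3) K, (x + y) ^ q = x ^ q + y ^ q) (hq : q ≠ 0)
    (hqq : ∀ x : K, (x ^ q) ^ q = x) {f : MvPolynomial (Fin 3) K} (h : IsHermitianCurve q f)
    (M : Matrix.GeneralLinearGroup (Fin 3) K) : IsHermitianCurve q (linearSubst M.val f) := by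
  obtain ⟨A, c, hA, rfl⟩ := h
  have hK : ∀ x y : K, (x + y) ^ q = x ^ q + y ^ q := fun x y => by
    have := hadd (C x) (C y)
    simp only [← C_add, ← C_pow] at this
    exact C_injective _ _ this
  have hdet : IsUnit ((M.val.map (· ^ q)).transpose * A.val * M.val).det := by
    have h1 : (M.val.map (· ^ q)).det = M.val.det ^ q := by
      let φ : K →+* K :=
        { toFun := (· ^ q)
          map_one' := one_pow q
          map_mul' := fun x y => mul_pow x y q
          map_zero' := zero_pow hq
          map_add' := hK }
      exact (φ.map_det M.val).symm
    rw [Matrix.det_mul, Matrix.det_mul, Matrix.det_transpose, h1]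
    have hM := (Matrix.isUnit_iff_isUnit_det _).1 M.isUnit
    exact ((hM.pow q).mul ((Matrix.isUnit_iff_isUnit_det _).1 A.isUnit)).mul hM
  refine ⟨Matrix.GeneralLinearGroup.mk'' _ hdet, c, fun i j => ?_, ?_⟩
  · change ((M.val.map (· ^ q)).transpose * A.val * M.val) j i =
      (((M.val.map (· ^ q)).transpose * A.val * M.val) i j) ^ q
    simp only [Matrix.mul_apply, Fin.sum_univ_three, Matrix.transpose_apply, Matrix.map_apply,
      hK, mul_pow, hqq, ← hA]
    ring
  · rw [linearSubst_C_mul, linearSubst_sesquilinear hadd]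
    rfl

theorem pderiv_linearSubst (M : Matrix (Fin 3) (Fin 3) K) (f : MvPolynomial (Fin 3) K)
    (j : Fin 3) :
    pderiv j (linearSubst M f) = ∑ i, C (M i j) * linearSubst M (pderiv i f) := by
  induction f using MvPolynomial.induction_on with
  | C a => simp [linearSubst]
  | add p q hp hq =>
    have h : ∀ p q : MvPolynomial (Fin 3) K, linearSubst M (p + q) =
        linearSubst M p + linearSubst M q := fun p q => map_add _ p q
    simp only [h, hp, hq, map_add, mul_add, Finset.sum_add_distrib]
  | mul_X p n hp =>
    have h : pderiv j (∑ k, C (M n k) * X k : MvPolynomial (Fin 3) K) = C (M n j) := by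
      simp [pderiv_X, Pi.single_apply]
    have hX : linearSubst M (X n) = ∑ k, C (M n k) * X k := bind₁_X_right _ _
    have hmul : ∀ p q : MvPolynomial (Fin 3) K, linearSubst M (p * q) =
        linearSubst M p * linearSubst M q := fun p q => map_mul _ p q
    have hadd : ∀ p q : MvPolynomial (Fin 3) K, linearSubst M (p + q) =
        linearSubst M p + linearSubst M q := fun p q => map_add _ p q
    have hs : ∀ i, linearSubst M (Pi.single (M := fun _ => MvPolynomial (Fin 3) K) i 1 n) =
        Pi.single (M := fun _ => MvPolynomial (Fin 3) K) i 1 n := fun i => by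
      by_cases hi : n = i
      · subst hi; simp [linearSubst]
      · simp [linearSubst, Pi.single_eq_of_ne hi]
    simp only [hmul, hX, pderiv_mul, h, hp, hadd, pderiv_X, hs, mul_add, Finset.sum_add_distrib,
      Finset.sum_mul]
    congr 1
    · exact Finset.sum_congr rfl fun i _ => by rw [mul_assoc]
    · simp [Pi.single_apply, mul_comm]

/-- By the chain rule the new gradient at `x` is the old gradient at `N x` times the invertible
matrix `N`. -/
theorem IsNonsingular.linearSubst {f : MvPolynomial (Fin 3) K} (hf : IsNonsingular f)
    (M : Matrix.GeneralLinearGroup (Fin 3) K) : IsNonsingular (linearSubst M.val f) := by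
  rintro x hx ⟨h0, h1⟩
  set N := M.val.map (algebraMap K (AlgebraicClosure K)) with hN
  have hdet : N.det ≠ 0 := by
    have : N.det = algebraMap K (AlgebraicClosure K) M.val.det :=
      ((algebraMap K (AlgebraicClosure K)).map_det M.val).symm
    rw [this, Ne, map_eq_zero]
    exact ((Matrix.isUnit_iff_isUnit_det _).1 M.isUnit).ne_zero
  refine hf (N.mulVec x) (fun h => hx (Matrix.eq_zero_of_mulVec_eq_zero hdet h))
    ⟨by rwa [aeval_linearSubst] at h0, ?_⟩
  have h2 : (fun i => aeval (N.mulVec x) (pderiv i f)) = 0 := by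
    apply Matrix.eq_zero_of_vecMul_eq_zero hdet
    ext j
    have := h1 j
    simp only [pderiv_linearSubst, map_sum, map_mul, aeval_C, aeval_linearSubst] at this
    simpa [Matrix.vecMul, dotProduct, hN, mul_comm] using this
  exact fun i => congrFun h2 i

/-! ### Coefficients of ternary cubics -/

/-- The ten monomials of degree three in three variables. -/
noncomputable def cubicMonomial : Fin 10 → MvPolynomial (Fin 3) K :=
  ![X 0 ^ 3, X 1 ^ 3, X 2 ^ 3, X 0 ^ 2 * X 1, X 0 * X 1 ^ 2,
    X 0 ^ 2 * X 2, X 0 * X 2 ^ 2, X 1 ^ 2 * X 2, X 1 * X 2 ^ 2, X 0 * X 1 * X 2]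

theorem exists_eq_sum_cubicMonomial {f : MvPolynomial (Fin 3) K} (hf : f.IsHomogeneous 3) :
    ∃ c : Fin 10 → K, f = ∑ i, c i • cubicMonomial i := by
  suffices h : f ∈ Submodule.span K (Set.range cubicMonomial) by
    obtain ⟨c, hc⟩ := (Submodule.mem_span_range_iff_exists_fun K).1 h
    exact ⟨c, hc.symm⟩
  rw [f.as_sum]
  refine Submodule.sum_mem _ fun e he => ?_
  have hd : e 0 + e 1 + e 2 = 3 := by
    have : e.degree = 3 := by
      rw [Finsupp.degree_eq_weight_one]
      exact hf (mem_support_iff.1 he)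
    rwa [Finsupp.degree_eq_sum, Fin.sum_univ_three] at this
  rw [monomial_eq, Finsupp.prod_fintype _ _ (by simp), Fin.prod_univ_three, ← smul_eq_C_mul]
  refine Submodule.smul_mem _ _ (Submodule.subset_span ?_)
  generalize e 0 = i at *
  generalize e 1 = j at *
  generalize e 2 = k at *
  have hi : i ≤ 3 := by omega
  interval_cases i
  · have hj : j ≤ 3 := by omega
    interval_cases j
    · obtain rfl : k = 3 := by omega
      exact ⟨2, by simp [cubicMonomial]⟩
    · obtain rfl : k = 2 := by omega
      exact ⟨8, by simp [cubicMonomial]⟩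
    · obtain rfl : k = 1 := by omega
      exact ⟨7, by simp [cubicMonomial]⟩
    · obtain rfl : k = 0 := by omega
      exact ⟨1, by simp [cubicMonomial]⟩
  · have hj : j ≤ 2 := by omega
    interval_cases j
    · obtain rfl : k = 2 := by omega
      exact ⟨6, by simp [cubicMonomial]⟩
    · obtain rfl : k = 1 := by omega
      exact ⟨9, by simp [cubicMonomial]⟩
    · obtain rfl : k = 0 := by omega
      exact ⟨4, by simp [cubicMonomial]⟩
  · have hj : j ≤ 1 := by omega
    interval_cases j
    · obtain rfl : k = 1 := by omega
      exact ⟨5, by simp [cubicMonomial]⟩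
    · obtain rfl : k = 0 := by omega
      exact ⟨3, by simp [cubicMonomial]⟩
  · obtain rfl : j = 0 := by omega
    obtain rfl : k = 0 := by omega
    exact ⟨0, by simp [cubicMonomial]⟩

theorem exists_cubic_coeffs {f : MvPolynomial (Fin 3) K} (hf : f.IsHomogeneous 3) :
    ∃ a₀ a₁ a₂ b₀₁ b₁₀ b₀₂ b₂₀ b₁₂ b₂₁ d : K,
      f = C a₀ * X 0 ^ 3 + C a₁ * X 1 ^ 3 + C a₂ * X 2 ^ 3 +
        C b₀₁ * (X 0 ^ 2 * X 1) + C b₁₀ * (X 0 * X 1 ^ 2) +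
        C b₀₂ * (X 0 ^ 2 * X 2) + C b₂₀ * (X 0 * X 2 ^ 2) +
        C b₁₂ * (X 1 ^ 2 * X 2) + C b₂₁ * (X 1 * X 2 ^ 2) + C d * (X 0 * X 1 * X 2) := by
  obtain ⟨c, rfl⟩ := exists_eq_sum_cubicMonomial hf
  refine ⟨c 0, c 1, c 2, c 3, c 4, c 5, c 6, c 7, c 8, c 9, ?_⟩
  simp only [Fin.sum_univ_castSucc, Finset.univ_eq_empty, Finset.sum_empty, smul_eq_C_mul]
  rw [zero_add]
  rfl

end PlaneCurve

/-! ### Nine-point sets in a projective plane of order 4 -/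

open Configuration in
-- The 5 lines through `p` partition the other 8 points of `S`, at most 2 to a line, so `8 ≤ 5 +
-- #trisecants`.
theorem Configuration.ProjectivePlane.three_le_card_trisecants {P L : Type*} [Fintype P] [Fintype L]
    [Membership P L] [ProjectivePlane P L] (hord : ProjectivePlane.order P L = 4) (S : Set P)
    (hS : S.ncard = 9) (hle : ∀ l : L, {x | x ∈ S ∧ x ∈ l}.ncard ≤ 3) {p : P} (hp : p ∈ S) :
    3 ≤ {l : L | p ∈ l ∧ {x | x ∈ S ∧ x ∈ l}.ncard = 3}.ncard := by
  classical
  let T : Finset P := S.toFinset.erase p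
  let N : Finset L := Finset.univ.filter (p ∈ ·)
  have hT : T.card = 8 := by
    rw [Finset.card_erase_of_mem (by simpa using hp), ← Set.ncard_eq_toFinset_card', hS]
  have hN : N.card = 5 := by
    have := ProjectivePlane.lineCount_eq L p
    rwa [hord, lineCount, Nat.card_eq_fintype_card, Fintype.card_subtype] at this
  have h1 : ∀ q ∈ T, (N.filter fun l => q ∈ l).card = 1 := by
    intro q hq
    have hne : p ≠ q := (Finset.ne_of_mem_erase hq).symm
    rw [Finset.card_eq_one]
    refine ⟨HasLines.mkLine hne, ?_⟩
    have hax := HasLines.mkLine_ax (P := P) (L := L) hne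
    ext l
    simp only [N, Finset.mem_filter, Finset.mem_univ, true_and, Finset.mem_singleton]
    refine ⟨fun h => ?_, fun h => h ▸ hax⟩
    exact (Nondegenerate.eq_or_eq h.1 h.2 hax.1 hax.2).resolve_left hne
  have hcount := Finset.sum_card_bipartiteAbove_eq_sum_card_bipartiteBelow
    (s := T) (t := N) (fun q l => q ∈ l)
  simp only [Finset.bipartiteAbove, Finset.bipartiteBelow] at hcount
  rw [Finset.sum_congr rfl h1, Finset.sum_const, hT] at hcount
  have h2 : ∀ l ∈ N, (T.filter fun q => q ∈ l).card + 1 = {x | x ∈ S ∧ x ∈ l}.ncard := by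
    intro l hl
    have hl' : p ∈ l := by simpa [N] using hl
    have : (T.filter fun q => q ∈ l) = ({x | x ∈ S ∧ x ∈ l} : Set P).toFinset.erase p := by
      ext x; simp [T, and_assoc]
    rw [this, Set.ncard_eq_toFinset_card', Finset.card_erase_add_one]
    simp [hp, hl']
  have h3 : ∀ l ∈ N, (T.filter fun q => q ∈ l).card ≤
      1 + if {x | x ∈ S ∧ x ∈ l}.ncard = 3 then 1 else 0 := by
    intro l hl
    have := h2 l hl
    have := hle l
    split_ifs <;> omega
  have h4 := Finset.sum_le_sum h3
  rw [← hcount, Finset.sum_add_distrib, Finset.sum_const, hN, ← Finset.card_filter] at h4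
  have h5 : {l : L | p ∈ l ∧ {x | x ∈ S ∧ x ∈ l}.ncard = 3}.ncard =
      (N.filter fun l => {x | x ∈ S ∧ x ∈ l}.ncard = 3).card := by
    rw [Set.ncard_eq_toFinset_card']
    congr 1
    ext l; simp [N]
  rw [h5]
  simp at h4
  omega

open Configuration in
theorem Configuration.ProjectivePlane.exists_trisecants_meeting_outside {P L : Type*} [Fintype P]
    [Fintype L] [Membership P L] [ProjectivePlane P L] (hord : ProjectivePlane.order P L = 4)
    (S : Set P) (hS : S.ncard = 9) (hle : ∀ l : L, {x | x ∈ S ∧ x ∈ l}.ncard ≤ 3) :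
    ∃ (l m : L) (p : P), l ≠ m ∧ {x | x ∈ S ∧ x ∈ l}.ncard = 3 ∧ {x | x ∈ S ∧ x ∈ m}.ncard = 3 ∧
      p ∈ l ∧ p ∈ m ∧ p ∉ S := by
  classical
  obtain ⟨p, hp⟩ : S.Nonempty := Set.nonempty_of_ncard_ne_zero (by omega)
  obtain ⟨T, hT, hT3⟩ := Set.exists_subset_card_eq
    (three_le_card_trisecants hord S hS hle hp)
  -- Three trisecants through `p` cover at most `1 + 3 * 2 = 7` of the 9 points.
  obtain ⟨d, hdS, hd⟩ : ∃ d ∈ S, ∀ l ∈ T, d ∉ l := by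
    by_contra! hcon
    have hsub : S.toFinset ⊆ insert p (T.toFinset.biUnion
        fun l => ({x | x ∈ S ∧ x ∈ l} : Set P).toFinset.erase p) := by
      intro x hx
      rw [Set.mem_toFinset] at hx
      obtain ⟨l, hl, hxl⟩ := hcon x hx
      by_cases hxp : x = p
      · simp [hxp]
      · rw [Finset.mem_insert, Finset.mem_biUnion]
        exact Or.inr ⟨l, by simpa using hl, by simp [hxp, hx, hxl]⟩
    have h1 := Finset.card_le_card hsub
    rw [← Set.ncard_eq_toFinset_card', hS] at h1
    have h2 := Finset.card_insert_le p (T.toFinset.biUnion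
        fun l => ({x | x ∈ S ∧ x ∈ l} : Set P).toFinset.erase p)
    have h3 := Finset.card_biUnion_le_card_mul T.toFinset
      (fun l => ({x | x ∈ S ∧ x ∈ l} : Set P).toFinset.erase p) 2 (by
        intro l hl
        have hl' := hT (by simpa using hl)
        rw [Finset.card_erase_of_mem (by simp [hp, hl'.1]), ← Set.ncard_eq_toFinset_card', hl'.2])
    rw [← Set.ncard_eq_toFinset_card', hT3] at h3
    omega
  obtain ⟨l₀, hl₀⟩ : T.Nonempty := Set.nonempty_of_ncard_ne_zero (by omega)
  have hdp : d ≠ p := fun h => hd l₀ hl₀ (h ▸ (hT hl₀).1)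
  -- Only one line joins `d` to `p`, while at least three trisecants pass through `d`.
  obtain ⟨m, ⟨hdm, hm3⟩, hpm⟩ : ∃ m ∈ {l : L | d ∈ l ∧ {x | x ∈ S ∧ x ∈ l}.ncard = 3}, p ∉ m := by
    have h3 := three_le_card_trisecants hord S hS hle hdS
    obtain ⟨m₁, hm₁, m₂, hm₂, hne⟩ := Set.one_lt_ncard_iff_nontrivial.1
      (show 1 < {l : L | d ∈ l ∧ {x | x ∈ S ∧ x ∈ l}.ncard = 3}.ncard by omega)
    by_contra! hcon
    exact ((Nondegenerate.eq_or_eq hm₁.1 (hcon _ hm₁) hm₂.1 (hcon _ hm₂)).resolve_left hdp) |> hne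
  have hlm : ∀ l ∈ T, l ≠ m := fun l hl h => hd l hl (h ▸ hdm)
  -- If `m` met all three lines of `T` inside `S`, these meeting points would be distinct and, with
  -- `d`, give four points of `S` on `m`.
  by_contra! hcon
  have hmeet : ∀ l ∈ T, ∃ x, x ∈ l ∧ x ∈ m ∧ x ∈ S := fun l hl =>
    have hax := HasPoints.mkPoint_ax (P := P) (hlm l hl)
    ⟨_, hax.1, hax.2, hcon l m _ (hlm l hl) (hT hl).2 hm3 hax.1 hax.2⟩
  have : Nonempty P := ⟨p⟩
  choose! g hgl hgm hgS using hmeet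
  have hinj : Set.InjOn g T := by
    intro l hl l' hl' h
    by_contra hne
    have h' := (Nondegenerate.eq_or_eq (hT hl).1 (hgl l hl) (hT hl').1
      (h ▸ hgl l' hl')).resolve_right hne
    exact hpm (h' ▸ hgm l hl)
  have hdg : d ∉ g '' T := by
    rintro ⟨l, hl, h⟩
    exact hd l hl (h ▸ hgl l hl)
  have hsub : insert d (g '' T) ⊆ {x | x ∈ S ∧ x ∈ m} := by
    rintro x (rfl | ⟨l, hl, rfl⟩)
    · exact ⟨hdS, hdm⟩
    · exact ⟨hgS l hl, hgm l hl⟩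
  have := Set.ncard_le_ncard hsub
  rw [Set.ncard_insert_of_notMem hdg, hinj.ncard_image] at this
  omega

open Configuration in
theorem Configuration.ProjectivePlane.exists_remaining_point {P L : Type*} [Fintype P]
    [Fintype L] [Membership P L] [ProjectivePlane P L] (hord : ProjectivePlane.order P L = 4)
    (S : Set P) {l : L} (hl : {x | x ∈ S ∧ x ∈ l}.ncard = 3) {p : P} (hp : p ∈ l) (hpS : p ∉ S) :
    ∃ q ∈ l, q ≠ p ∧ q ∉ S ∧ ∀ x ∈ l, x ≠ p → x ≠ q → x ∈ S := by
  classical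
  have h5 : {x | x ∈ l}.ncard = 5 := by
    have := ProjectivePlane.pointCount_eq P l
    rwa [hord] at this
  have h2 : ({x | x ∈ l} \ {x | x ∈ S ∧ x ∈ l}).ncard = 2 := by
    rw [Set.ncard_sdiff (fun x hx => hx.2), h5, hl]
  obtain ⟨a, b, hab, h⟩ := Set.ncard_eq_two.1 h2
  have key : ∀ x, (x ∈ l ∧ x ∉ S) ↔ x = a ∨ x = b := fun x => by
    have := Set.ext_iff.1 h x
    simp only [Set.mem_sdiff, Set.mem_ofPred_eq, Set.mem_insert_iff, Set.mem_singleton_iff] at this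
    tauto
  rcases (key p).1 ⟨hp, hpS⟩ with rfl | rfl
  · have := (key b).2 (Or.inr rfl)
    refine ⟨b, this.1, hab.symm, this.2, fun x hx h1 h2 => ?_⟩
    by_contra h3
    exact ((key x).1 ⟨hx, h3⟩).elim h1 h2
  · have := (key a).2 (Or.inl rfl)
    refine ⟨a, this.1, hab, this.2, fun x hx h1 h2 => ?_⟩
    by_contra h3
    exact ((key x).1 ⟨hx, h3⟩).elim h2 h1

/-! ### Arithmetic and point counting over the field with four elements -/

namespace PlaneCurve.FieldFour

variable {K : Type*} [Field K]

theorem pow_four (hK : Nat.card K = 4) (x : K) : x ^ 4 = x := by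
  have : Finite K := Nat.finite_of_card_ne_zero (by omega)
  have := Fintype.ofFinite K
  have h := FiniteField.pow_card x
  rwa [← Nat.card_eq_fintype_card, hK] at h

theorem pow_three (hK : Nat.card K = 4) {x : K} (hx : x ≠ 0) : x ^ 3 = 1 :=
  mul_right_cancel₀ hx (by rw [← pow_succ, pow_four hK, one_mul])

theorem two_eq_zero (hK : Nat.card K = 4) : (2 : K) = 0 := by
  have h := pow_four hK (-1 : K)
  linear_combination h

theorem sq_omega (hK : Nat.card K = 4) {ω : K} (hω0 : ω ≠ 0) (hω1 : ω ≠ 1) : ω ^ 2 = ω + 1 := by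
  have h := pow_three hK hω0
  refine mul_left_cancel₀ (sub_ne_zero.2 hω1) ?_
  linear_combination h - (ω ^ 2 - 1) * two_eq_zero hK

theorem eq_or (hK : Nat.card K = 4) {ω : K} (hω0 : ω ≠ 0) (hω1 : ω ≠ 1) (x : K) :
    x = 0 ∨ x = 1 ∨ x = ω ∨ x = ω ^ 2 := by
  by_cases h0 : x = 0
  · exact Or.inl h0
  have h := pow_three hK h0
  have hω := pow_three hK hω0
  have h2 := sq_omega hK hω0 hω1
  have : (x - 1) * ((x - ω) * (x - ω ^ 2)) = 0 := by
    linear_combination h + (x - x ^ 2) * h2 + (x - 1) * hω +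
      (x + x * ω - x ^ 2 - x ^ 2 * ω) * two_eq_zero hK
  simpa [sub_eq_zero, h0] using this

/-- Enumeration of a field with four elements, sending the bits `s + 2 t` to `s + t * ω`. -/
def ofNat (ω : K) : ℕ → K
  | 0 => 0
  | 1 => 1
  | 2 => ω
  | _ => ω ^ 2

/-- Multiplication of the field with four elements on codes, read off a table of bits. -/
def codeMul (a b : ℕ) : ℕ :=
  -- The constant is `0x9C78E400`: byte `a`, counted from the lowest, is row `a` of the
  -- multiplication table, two bits per entry.
  (2625168384 >>> (8 * a + 2 * b)) &&& 3

theorem sum_eq (hK : Nat.card K = 4) [Fintype K] {ω : K} (hω0 : ω ≠ 0) (hω1 : ω ≠ 1) (g : K → ℕ) :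
    ∑ x, g x = g (ofNat ω 0) + g (ofNat ω 1) + g (ofNat ω 2) + g (ofNat ω 3) := by
  classical
  have h : (Finset.univ : Finset K) = {0, 1, ω, ω ^ 2} := by
    ext x
    simpa using eq_or hK hω0 hω1 x
  have h2 := sq_omega hK hω0 hω1
  rw [h, Finset.sum_insert, Finset.sum_insert, Finset.sum_insert, Finset.sum_singleton]
  · simp only [ofNat, add_assoc]
  · rw [Finset.mem_singleton, h2]
    simp
  · rw [Finset.mem_insert, Finset.mem_singleton, h2, right_eq_add]
    simp [hω0, hω1.symm]
  · simp [hω0.symm, (pow_ne_zero 2 hω0).symm]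

theorem exists_ofNat (hK : Nat.card K = 4) {ω : K} (hω0 : ω ≠ 0) (hω1 : ω ≠ 1) (x : K) :
    ∃ i < 4, x = ofNat ω i := by
  rcases eq_or hK hω0 hω1 x with rfl | rfl | rfl | rfl
  exacts [⟨0, by simp [ofNat]⟩, ⟨1, by simp [ofNat]⟩, ⟨2, by simp [ofNat]⟩, ⟨3, by simp [ofNat]⟩]

theorem code_lt : ∀ a < 4, ∀ b < 4, a ^^^ b < 4 ∧ codeMul a b < 4 := by decide

/-- In characteristic two, addition acts bitwise on coordinates in the basis `1, ω`; the code 3 fits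
because `ω² = ω + 1`. -/
theorem ofNat_xor (hK : Nat.card K = 4) {ω : K} (hω0 : ω ≠ 0) (hω1 : ω ≠ 1) {a b : ℕ}
    (ha : a < 4) (hb : b < 4) : ofNat ω (a ^^^ b) = ofNat ω a + ofNat ω b := by
  have h2 := sq_omega hK hω0 hω1
  have h := two_eq_zero hK
  interval_cases a <;> interval_cases b <;> simp only [Nat.reduceXor, ofNat, h2] <;> grind

theorem ofNat_codeMul (hK : Nat.card K = 4) {ω : K} (hω0 : ω ≠ 0) (hω1 : ω ≠ 1) {a b : ℕ}
    (ha : a < 4) (hb : b < 4) : ofNat ω (codeMul a b) = ofNat ω a * ofNat ω b := by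
  have h3 := pow_three hK hω0
  interval_cases a <;> interval_cases b <;> simp [codeMul, ofNat] <;> grind

theorem ofNat_eq_zero {ω : K} (hω0 : ω ≠ 0) {a : ℕ} (ha : a < 4) : ofNat ω a = 0 ↔ a = 0 := by
  interval_cases a <;> simp [ofNat, hω0]

/-- Code of `x ^ 3 + y ^ 3 + z ^ 3 + b * (y ^ 2 * z) + c * (y * z ^ 2) + d * (x * y * z)`. -/
def codeCubic (b c d x y z : ℕ) : ℕ :=
  codeMul (codeMul x x) x ^^^ codeMul (codeMul y y) y ^^^ codeMul (codeMul z z) z ^^^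
    codeMul b (codeMul (codeMul y y) z) ^^^ codeMul c (codeMul y (codeMul z z)) ^^^
    codeMul d (codeMul (codeMul x y) z)

theorem codeCubic_spec (hK : Nat.card K = 4) {ω : K} (hω0 : ω ≠ 0) (hω1 : ω ≠ 1)
    {b c d x y z : ℕ} (hb : b < 4) (hc : c < 4) (hd : d < 4) (hx : x < 4) (hy : y < 4)
    (hz : z < 4) :
    ofNat ω x ^ 3 + ofNat ω y ^ 3 + ofNat ω z ^ 3 + ofNat ω b * (ofNat ω y ^ 2 * ofNat ω z) +
      ofNat ω c * (ofNat ω y * ofNat ω z ^ 2) + ofNat ω d * (ofNat ω x * ofNat ω y * ofNat ω z)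
      = 0 ↔ codeCubic b c d x y z = 0 := by
  have hm : ∀ {a b}, a < 4 → b < 4 → codeMul a b < 4 := fun ha hb => (code_lt _ ha _ hb).2
  have ha : ∀ {a b}, a < 4 → b < 4 → a ^^^ b < 4 := fun ha hb => (code_lt _ ha _ hb).1
  have h1 := hm (hm hx hx) hx
  have h2 := hm (hm hy hy) hy
  have h3 := hm (hm hz hz) hz
  have h4 := hm hb (hm (hm hy hy) hz)
  have h5 := hm hc (hm hy (hm hz hz))
  have h6 := hm hd (hm (hm hx hy) hz)
  have A := @ofNat_xor K _ hK ω hω0 hω1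
  have M := @ofNat_codeMul K _ hK ω hω0 hω1
  rw [codeCubic, ← ofNat_eq_zero hω0 (ha (ha (ha (ha (ha h1 h2) h3) h4) h5) h6),
    A (ha (ha (ha (ha h1 h2) h3) h4) h5) h6, A (ha (ha (ha h1 h2) h3) h4) h5,
    A (ha (ha h1 h2) h3) h4, A (ha h1 h2) h3, A h1 h2, M (hm hx hx) hx, M hx hx,
    M (hm hy hy) hy, M hb (hm (hm hy hy) hz), M (hm hy hy) hz, M hy hy, M (hm hz hz) hz,
    M hc (hm hy (hm hz hz)), M hy (hm hz hz), M hz hz, M hd (hm (hm hx hy) hz), M (hm hx hy) hz,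
    M hx hy]
  ring_nf

/-- Sum over the four codes. -/
def codeSum (g : ℕ → ℕ) : ℕ := g 0 + g 1 + g 2 + g 3

/-- Number of zeros of the cubic with coded coefficients `b`, `c`, `d`. -/
def codeCount (b c d : ℕ) : ℕ :=
  codeSum fun x => codeSum fun y => codeSum fun z => if codeCubic b c d x y z = 0 then 1 else 0

/-- Exhaustion over 64 cubics at 64 vectors each; coding by natural numbers lets the kernel evaluate
it although `K` is abstract. -/
theorem codeCubic_count : ∀ b c d : Fin 4,
    codeCount b c d = 28 → d.val = 0 ∧ (b.val = 0 ∨ c.val = 0) := by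
  decide +kernel

theorem cubic_count (hK : Nat.card K = 4) {b c d : K}
    (h : Nat.card {v : Fin 3 → K // v 0 ^ 3 + v 1 ^ 3 + v 2 ^ 3 + b * (v 1 ^ 2 * v 2) +
      c * (v 1 * v 2 ^ 2) + d * (v 0 * v 1 * v 2) = 0} = 28) : d = 0 ∧ (b = 0 ∨ c = 0) := by
  classical
  have : Finite K := Nat.finite_of_card_ne_zero (by omega)
  have := Fintype.ofFinite K
  obtain ⟨ω, hω⟩ : ∃ ω : K, ω ∉ ({0, 1} : Finset K) := by
    by_contra! hcon
    have := Finset.card_le_card (show (Finset.univ : Finset K) ⊆ {0, 1} from fun x _ => hcon x)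
    rw [Finset.card_univ, ← Nat.card_eq_fintype_card, hK] at this
    exact absurd (this.trans Finset.card_le_two) (by norm_num)
  simp only [Finset.mem_insert, Finset.mem_singleton, not_or] at hω
  obtain ⟨hω0, hω1⟩ := hω
  obtain ⟨b, hb, rfl⟩ := exists_ofNat hK hω0 hω1 b
  obtain ⟨c, hc, rfl⟩ := exists_ofNat hK hω0 hω1 c
  obtain ⟨d, hd, rfl⟩ := exists_ofNat hK hω0 hω1 d
  rw [ofNat_eq_zero hω0 hb, ofNat_eq_zero hω0 hc, ofNat_eq_zero hω0 hd]
  refine codeCubic_count ⟨b, hb⟩ ⟨c, hc⟩ ⟨d, hd⟩ ?_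
  let e : (Fin 3 → K) ≃ K × K × K :=
    { toFun := fun v => (v 0, v 1, v 2)
      invFun := fun t => ![t.1, t.2.1, t.2.2]
      left_inv := fun v => by ext i; fin_cases i <;> rfl
      right_inv := fun t => rfl }
  rw [Nat.card_eq_fintype_card, Fintype.card_subtype, Finset.card_filter] at h
  have h := (Fintype.sum_equiv e _ (fun t => if t.1 ^ 3 + t.2.1 ^ 3 + t.2.2 ^ 3 +
      ofNat ω b * (t.2.1 ^ 2 * t.2.2) + ofNat ω c * (t.2.1 * t.2.2 ^ 2) +
      ofNat ω d * (t.1 * t.2.1 * t.2.2) = 0 then 1 else 0) (fun v => rfl)).symm.trans h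
  rw [Fintype.sum_prod_type] at h
  simp only [Fintype.sum_prod_type] at h
  rw [← h]
  simp only [sum_eq hK hω0 hω1]
  have key : ∀ {x y z : ℕ}, x < 4 → y < 4 → z < 4 → _ := fun hx hy hz =>
    codeCubic_spec hK hω0 hω1 hb hc hd hx hy hz
  simp only [codeCount, codeSum]
  simp (discharger := norm_num) only [key]

end PlaneCurve.FieldFour

/-! ### Cubics, lines and coordinate frames -/

namespace PlaneCurve

variable {K : Type*} [Field K]

/-- The form is `x₂ Q`, whose gradient on `x₂ = 0` is `(0, 0, Q)`; the binary quadratic `Q(s, t, 0)`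
has a zero over the algebraic closure. -/
theorem not_isNonsingular_of_line (b₀ b₁ b₂ c₀ c₁ c₂ : K) :
    ¬ IsNonsingular (C c₂ * X 2 ^ 3 + C b₀ * (X 0 ^ 2 * X 2) + C c₀ * (X 0 * X 2 ^ 2) +
      C b₁ * (X 1 ^ 2 * X 2) + C c₁ * (X 1 * X 2 ^ 2) + C b₂ * (X 0 * X 1 * X 2) :
        MvPolynomial (Fin 3) K) := by
  intro h
  obtain ⟨s, t, hst, hz⟩ : ∃ s t : AlgebraicClosure K, (s ≠ 0 ∨ t ≠ 0) ∧
      algebraMap K _ b₀ * s ^ 2 + algebraMap K _ b₁ * t ^ 2 + algebraMap K _ b₂ * (s * t) = 0 := by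
    by_cases hb : algebraMap K (AlgebraicClosure K) b₀ = 0
    · exact ⟨1, 0, by simp, by simp [hb]⟩
    · obtain ⟨s, hs⟩ := IsAlgClosed.exists_root
        (Polynomial.C (algebraMap K (AlgebraicClosure K) b₀) * Polynomial.X ^ 2 +
          Polynomial.C (algebraMap K _ b₂) * Polynomial.X + Polynomial.C (algebraMap K _ b₁))
        (by rw [Polynomial.degree_quadratic hb]; decide)
      refine ⟨s, 1, by simp, ?_⟩
      simp only [Polynomial.IsRoot.def, Polynomial.eval_add, Polynomial.eval_mul,
        Polynomial.eval_C, Polynomial.eval_pow, Polynomial.eval_X] at hs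
      linear_combination hs
  refine h ![s, t, 0] (fun h0 => ?_) ⟨by simp, fun i => ?_⟩
  · have h1 := congrFun h0 0
    have h2 := congrFun h0 1
    simp at h1 h2
    exact hst.elim (· h1) (· h2)
  · fin_cases i
    · simp [pderiv_X]
    · simp [pderiv_X]
    · simp [pderiv_X]
      linear_combination hz

/-- The affine cone has the origin and three nonzero multiples for each point: `1 + 9 * 3 = 28`. -/
theorem card_zeros (hK : Nat.card K = 4) {f : MvPolynomial (Fin 3) K} (hf : f.IsHomogeneous 3)
    (hN : (rationalPoints f).ncard = 9) : Nat.card {v : Fin 3 → K // eval v f = 0} = 28 := by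
  classical
  have : Finite K := Nat.finite_of_card_ne_zero (by omega)
  have := Fintype.ofFinite K
  have h0 : eval (0 : Fin 3 → K) f = 0 := by
    rw [eval_zero]
    exact hf.coeff_eq_zero (by simp)
  have hrep : ∀ (t : rationalPoints f) (a : Kˣ),
      a • t.1.rep ≠ 0 ∧ ∀ h, Projectivization.mk K (a • t.1.rep) h = t.1 := fun t a =>
    ⟨(smul_ne_zero_iff_ne a).2 t.1.rep_nonzero, fun h => by
      conv_rhs => rw [← t.1.mk_rep]
      exact (Projectivization.mk_eq_mk_iff K _ _ _ _).2 ⟨a, rfl⟩⟩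
  let φ : rationalPoints f × Kˣ → {v : {v : Fin 3 → K // v ≠ 0} // eval v.1 f = 0} := fun t =>
    ⟨⟨t.2 • t.1.1.rep, (hrep t.1 t.2).1⟩, by
      rw [← mk_mem_rationalPoints hf _ (hrep t.1 t.2).1, (hrep t.1 t.2).2]
      exact t.1.2⟩
  have hφ : Function.Bijective φ := by
    constructor
    · rintro ⟨t, a⟩ ⟨t', a'⟩ h
      have hv : a • t.1.rep = a' • t'.1.rep := congrArg (fun w => w.1.1) h
      have ht : t = t' := by
        ext1
        rw [← (hrep t a).2 (hrep t a).1, ← (hrep t' a').2 (hrep t' a').1]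
        congr 1
      subst ht
      have ha : (a : K) = a' := smul_left_injective K t.1.rep_nonzero hv
      rw [Units.ext ha]
    · rintro ⟨⟨v, hv⟩, hz⟩
      obtain ⟨a, ha⟩ := Projectivization.exists_smul_eq_mk_rep K v hv
      refine ⟨(⟨Projectivization.mk K v hv, (mk_mem_rationalPoints hf v hv).2 hz⟩, a⁻¹), ?_⟩
      apply Subtype.ext
      apply Subtype.ext
      change a⁻¹ • (Projectivization.mk K v hv).rep = v
      rw [← ha, inv_smul_smul]
  have e1 := (Equiv.ofBijective φ hφ).symm
  have h1 := Nat.card_congr e1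
  rw [Nat.card_prod, Nat.card_coe_set_eq, hN, Nat.card_units, hK] at h1
  have e2 : {v : Fin 3 → K // eval v f = 0} ≃
      Option {v : {v : Fin 3 → K // v ≠ 0} // eval v.1 f = 0} :=
    { toFun := fun v => if h : v.1 = 0 then none else some ⟨⟨v.1, h⟩, v.2⟩
      invFun := fun o => o.elim ⟨0, h0⟩ fun w => ⟨w.1.1, w.2⟩
      left_inv := fun v => by
        by_cases h : v.1 = 0
        · ext1; simp [h]
        · simp [h]
      right_inv := fun o => by
        cases o with
        | none => simp
        | some w => simp [w.1.2] }
  rw [Nat.card_congr e2, Finite.card_option, h1]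

/-- The matrix whose columns are representatives of three points. -/
noncomputable def frame (p q r : Projectivization K (Fin 3 → K)) : Matrix (Fin 3) (Fin 3) K :=
  (Matrix.of ![p.rep, q.rep, r.rep]).transpose

theorem frame_mulVec (p q r : Projectivization K (Fin 3 → K)) (v : Fin 3 → K) :
    (frame p q r).mulVec v = v 0 • p.rep + v 1 • q.rep + v 2 • r.rep := by
  ext i
  simp [frame, Matrix.mulVec, dotProduct, Fin.sum_univ_three, mul_comm]

open Configuration in
theorem mem_line_iff (p l : Projectivization K (Fin 3 → K)) : p ∈ l ↔ p.rep ⬝ᵥ l.rep = 0 := by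
  conv_lhs => rw [← p.mk_rep, ← l.mk_rep]
  exact Projectivization.orthogonal_mk _ _

open Configuration in
-- Pairing a linear relation with `l` kills the coefficient of `r`; what remains is a relation
-- between the distinct points `p`, `q`.
theorem det_frame_ne_zero {p q r l : Projectivization K (Fin 3 → K)} (hpq : p ≠ q) (hp : p ∈ l)
    (hq : q ∈ l) (hr : r ∉ l) : (frame p q r).det ≠ 0 := by
  rw [mem_line_iff] at hp hq hr
  intro h
  obtain ⟨v, hv, hz⟩ := Matrix.exists_mulVec_eq_zero_iff.2 h
  rw [frame_mulVec] at hz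
  have h2 : v 2 = 0 := by
    have := congrArg (· ⬝ᵥ l.rep) hz
    simpa [add_dotProduct, hp, hq, hr] using this
  rw [h2, zero_smul, add_zero] at hz
  have hli := LinearIndependent.pair_iff.1 (Projectivization.linearIndependent_pair_iff_ne.2 hpq)
    (v 0) (v 1) hz
  exact hv (by ext i; fin_cases i <;> simp [hli, h2])

theorem eq_zero_of_smul_add_smul {p q : Projectivization K (Fin 3 → K)} (hpq : p ≠ q) {s t : K}
    (h : s • p.rep + t • q.rep = 0) : s = 0 ∧ t = 0 :=
  LinearIndependent.pair_iff.1 (Projectivization.linearIndependent_pair_iff_ne.2 hpq) s t h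

open Configuration in
theorem exists_coords {p q l x : Projectivization K (Fin 3 → K)} (hpq : p ≠ q) (hp : p ∈ l)
    (hq : q ∈ l) (hx : x ∈ l) : ∃ s t : K, x.rep = s • p.rep + t • q.rep := by
  obtain ⟨r, hr⟩ := Nondegenerate.exists_point (P := Projectivization K (Fin 3 → K)) l
  have hdet := det_frame_ne_zero hpq hp hq hr
  have h : (frame p q r).mulVec ((frame p q r)⁻¹.mulVec x.rep) = x.rep := by
    rw [Matrix.mulVec_mulVec, Matrix.mul_nonsing_inv _ hdet.isUnit, Matrix.one_mulVec]
  rw [frame_mulVec] at h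
  rw [mem_line_iff] at hp hq hr hx
  set v := (frame p q r)⁻¹.mulVec x.rep
  have h2 : v 2 = 0 := by
    rw [← h] at hx
    simpa [add_dotProduct, hp, hq, hr] using hx
  exact ⟨v 0, v 1, by rw [← h, h2, zero_smul, add_zero]⟩

open Configuration in
theorem mk_smul_add_smul {p q l : Projectivization K (Fin 3 → K)} (hpq : p ≠ q) (hp : p ∈ l)
    (hq : q ∈ l) {s t : K} (hs : s ≠ 0) (ht : t ≠ 0) : ∃ h : s • p.rep + t • q.rep ≠ 0,
      Projectivization.mk K _ h ∈ l ∧ Projectivization.mk K _ h ≠ p ∧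
        Projectivization.mk K _ h ≠ q := by
  have h : s • p.rep + t • q.rep ≠ 0 := fun h => hs (eq_zero_of_smul_add_smul hpq h).1
  refine ⟨h, ?_, fun he => ?_, fun he => ?_⟩
  · rw [mem_line_iff] at hp hq
    have horth := (Projectivization.orthogonal_mk h l.rep_nonzero).2
      (by simp [add_dotProduct, hp, hq])
    rwa [l.mk_rep] at horth
  · obtain ⟨a, ha⟩ := (Projectivization.mk_eq_mk_iff' K _ _ _ _).1 (he.trans p.mk_rep.symm)
    exact ht (eq_zero_of_smul_add_smul (s := s - a) hpq (by rw [sub_smul, ha]; abel)).2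
  · obtain ⟨a, ha⟩ := (Projectivization.mk_eq_mk_iff' K _ _ _ _).1 (he.trans q.mk_rep.symm)
    exact hs (eq_zero_of_smul_add_smul (t := t - a) hpq (by rw [sub_smul, ha]; abel)).1

open Configuration in
theorem ncard_rationalPoints_inter_line_le {f : MvPolynomial (Fin 3) K}
    (hf : f.IsHomogeneous 3) (hns : IsNonsingular f) (l : Projectivization K (Fin 3 → K)) :
    {x | x ∈ rationalPoints f ∧ x ∈ l}.ncard ≤ 3 := by
  by_contra! hcon
  obtain ⟨T, hT, hT4⟩ := Set.exists_subset_card_eq (n := 4) hcon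
  obtain ⟨p, T', hpT', rfl, hT3⟩ := Set.eq_insert_of_ncard_eq_succ hT4
  obtain ⟨q, x, y, hqx, hqy, hxy, rfl⟩ := Set.ncard_eq_three.1 hT3
  simp only [Set.mem_insert_iff, Set.mem_singleton_iff, not_or] at hpT'
  obtain ⟨hpq, hpx, hpy⟩ := hpT'
  have hp := hT (by simp : p ∈ _)
  have hq := hT (by simp : q ∈ _)
  have hx := hT (by simp : x ∈ _)
  have hy := hT (by simp : y ∈ _)
  obtain ⟨r, hr⟩ := Nondegenerate.exists_point (P := Projectivization K (Fin 3 → K)) l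
  have hdet := det_frame_ne_zero hpq hp.2 hq.2 hr
  let M := Matrix.GeneralLinearGroup.mkOfDetNeZero _ hdet
  have hns' := hns.linearSubst M
  obtain ⟨a₀, a₁, a₂, b₀₁, b₁₀, b₀₂, b₂₀, b₁₂, b₂₁, d, hf'⟩ :=
    exists_cubic_coeffs (isHomogeneous_linearSubst M.val hf)
  have hev : ∀ s t : K, eval (s • p.rep + t • q.rep) f =
      a₀ * s ^ 3 + a₁ * t ^ 3 + b₀₁ * (s ^ 2 * t) + b₁₀ * (s * t ^ 2) := fun s t => by
    have h := eval_linearSubst M.val f ![s, t, 0]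
    rw [hf'] at h
    change _ = eval ((frame p q r).mulVec _) f at h
    rw [frame_mulVec] at h
    simpa using h.symm
  have h0 : a₀ = 0 := by
    have := hev 1 0
    rw [one_smul, zero_smul, add_zero, show eval p.rep f = 0 from hp.1] at this
    simpa using this.symm
  have h1 : a₁ = 0 := by
    have := hev 0 1
    rw [one_smul, zero_smul, zero_add, show eval q.rep f = 0 from hq.1] at this
    simpa using this.symm
  subst h0 h1
  have key : ∀ z, p ≠ z → q ≠ z → z ∈ rationalPoints f → z ∈ l → ∃ s t : K,
      z.rep = s • p.rep + t • q.rep ∧ t ≠ 0 ∧ b₀₁ * s + b₁₀ * t = 0 := by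
    intro z hpz hqz hzf hzl
    obtain ⟨s, t, hst⟩ := exists_coords hpq hp.2 hq.2 hzl
    have hs : s ≠ 0 := by
      rintro rfl
      exact one_ne_zero (eq_zero_of_smul_add_smul (s := -t) hqz (t := 1)
        (by rw [hst]; simp)).2
    have ht : t ≠ 0 := by
      rintro rfl
      exact one_ne_zero (eq_zero_of_smul_add_smul (s := -s) hpz (t := 1)
        (by rw [hst]; simp)).2
    have h := hev s t
    rw [← hst, show eval z.rep f = 0 from hzf] at h
    refine ⟨s, t, hst, ht, mul_left_cancel₀ (mul_ne_zero hs ht) ?_⟩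
    linear_combination -h
  -- On `l` the cubic is now `st (b₀₁ s + b₁₀ t)`. Two further distinct zeros force both
  -- coefficients to vanish, making the cubic divisible by `x₂`.
  obtain ⟨s, t, hst, ht, h1⟩ := key x hpx hqx hx.1 hx.2
  obtain ⟨s', t', hst', ht', h2⟩ := key y hpy hqy hy.1 hy.2
  have hd : s * t' - s' * t ≠ 0 := fun hd => by
    refine ht' (eq_zero_of_smul_add_smul (s := t') (t := -t) hxy ?_).1
    rw [hst, hst']
    have : t' * s - t * s' = 0 := by linear_combination hd
    calc _ = (t' * s - t * s') • p.rep := by module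
      _ = 0 := by rw [this, zero_smul]
  have hb₁ : b₀₁ = 0 := mul_left_cancel₀ hd (by linear_combination t' * h1 - t * h2)
  subst hb₁
  have hb₂ : b₁₀ = 0 := mul_left_cancel₀ ht (by linear_combination h1)
  subst hb₂
  refine not_isNonsingular_of_line b₀₂ b₁₂ d b₂₀ b₂₁ a₂ ?_
  rw [hf'] at hns'
  simpa using hns'

end PlaneCurve

/-! ### Normal form and classification -/

namespace PlaneCurve

variable {K : Type*} [Field K]

theorem C_add_sq (hK : Nat.card K = 4) (x y : MvPolynomial (Fin 3) K) :
    (x + y) ^ 2 = x ^ 2 + y ^ 2 := by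
  have h := congrArg (C (σ := Fin 3)) (FieldFour.two_eq_zero hK)
  rw [C_0, map_ofNat] at h
  linear_combination (x * y) * h

theorem IsHermitianCurve.linearSubst_two (hK : Nat.card K = 4) {f : MvPolynomial (Fin 3) K}
    (h : IsHermitianCurve 2 f) (M : Matrix.GeneralLinearGroup (Fin 3) K) :
    IsHermitianCurve 2 (PlaneCurve.linearSubst M.val f) := by
  exact h.linearSubst (C_add_sq hK) two_ne_zero
    (fun x => by rw [← pow_mul, FieldFour.pow_four hK]) M

theorem not_isHermitianCurve_of_projEquiv (hK : Nat.card K = 4) {ω : K} (hω0 : ω ≠ 0)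
    (hω1 : ω ≠ 1) {f : MvPolynomial (Fin 3) K}
    (hf : ProjEquiv f (X 0 ^ 3 + C ω * X 1 ^ 3 + C (ω ^ 2) * X 2 ^ 3)) :
    ¬ IsHermitianCurve 2 f := by
  intro h
  obtain ⟨M, c, hM⟩ := hf
  obtain ⟨A, c', hA, hAM⟩ := h.linearSubst_two hK M
  rw [hM] at hAM
  have h0 := congrArg (eval ![1, 0, 0]) hAM
  have h1 := congrArg (eval ![0, 1, 0]) hAM
  simp [Fin.sum_univ_three] at h0 h1
  have hc : (c' : K) ≠ 0 := c'.ne_zero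
  have hA0 : A.val 0 0 ≠ 0 := fun h => c.ne_zero (by rw [h0, h, mul_zero])
  -- Diagonal entries satisfy `a = a²`. Being nonzero, `A 0 0` is 1, so the scalars `c` and `c'`
  -- agree and `A 1 1 = ω`, which would force `ω² = ω`.
  have hA00 : A.val 0 0 = 1 := mul_left_cancel₀ hA0 (by linear_combination -hA 0 0)
  rw [hA00, mul_one] at h0
  rw [h0] at h1
  have h2 : ω = A.val 1 1 := mul_left_cancel₀ hc h1
  have h3 := hA 1 1
  rw [← h2] at h3
  exact hω1 (mul_left_cancel₀ hω0 (by linear_combination -h3))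

theorem eq_zero_of_quadratic (hK : Nat.card K = 4) {ω : K} (hω0 : ω ≠ 0) (hω1 : ω ≠ 1)
    {a b c : K} (h : ∀ t, t ≠ 0 → a + b * t + c * t ^ 2 = 0) : a = 0 ∧ b = 0 ∧ c = 0 := by
  have h1 := h 1 one_ne_zero
  have h2 := h ω hω0
  have h3 := h (ω ^ 2) (pow_ne_zero 2 hω0)
  have hω := FieldFour.sq_omega hK hω0 hω1
  have two := FieldFour.two_eq_zero hK
  -- Adding the three values gives `3a = a`, since `1 + ω + ω² = 0` and likewise for the squares.
  have ha : a = 0 := by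
    linear_combination h1 + h2 + h3 - a * two - b * hω - c * (ω ^ 2 + ω + 3) * hω -
      (b * ω + b + c * (2 * ω + 2)) * two
  subst ha
  have hc : c = 0 := by grind
  subst hc
  simpa using h1

theorem isHermitianCurve_fermat (c : Kˣ) :
    IsHermitianCurve 2 (C (c : K) * (X 0 ^ 3 + X 1 ^ 3 + X 2 ^ 3) : MvPolynomial (Fin 3) K) := by
  refine ⟨1, c, fun i j => ?_, ?_⟩
  · by_cases h : i = j
    · simp [h]
    · simp [h, Ne.symm h]
  · change _ = C (c : K) * ∑ i, ∑ j, C ((1 : Matrix (Fin 3) (Fin 3) K) i j) * X i ^ 2 * X j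
    simp only [Matrix.one_apply, apply_ite C, C_1, C_0, ite_mul, one_mul, zero_mul,
      Finset.sum_ite_eq, Finset.mem_univ, if_true, Fin.sum_univ_three]
    ring

/-- These compare coefficients in `ω (y + ωb z)³ + ω² (y + ω²b z)³ = y³ + b y²z + z³`, the identity
that diagonalizes the binary part. -/
theorem omega_relations (hK : Nat.card K = 4) {ω b : K} (hω0 : ω ≠ 0) (hω1 : ω ≠ 1)
    (hb : b ≠ 0) : ω + ω ^ 2 = 1 ∧ 3 * ω ^ 2 + 3 * ω ^ 4 = 1 ∧ 3 * ω ^ 3 + 3 * ω ^ 6 = 0 ∧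
      b ^ 3 * (ω ^ 4 + ω ^ 8) = 1 := by
  have hω := FieldFour.sq_omega hK hω0 hω1
  have two := FieldFour.two_eq_zero hK
  have h3 := FieldFour.pow_three hK hω0
  rw [FieldFour.pow_three hK hb]
  refine ⟨?_, ?_, ?_, ?_⟩ <;> grind

theorem projEquiv_diagonal_left (hK : Nat.card K = 4) {ω b : K} (hω0 : ω ≠ 0) (hω1 : ω ≠ 1)
    (hb : b ≠ 0) (c : Kˣ) :
    ProjEquiv (C (c : K) * (X 0 ^ 3 + X 1 ^ 3 + X 2 ^ 3 + C b * (X 1 ^ 2 * X 2)))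
      (X 0 ^ 3 + C ω * X 1 ^ 3 + C (ω ^ 2) * X 2 ^ 3) := by
  have hdet : (!![1, 0, 0; 0, 1, ω * b; 0, 1, ω ^ 2 * b] : Matrix (Fin 3) (Fin 3) K).det ≠ 0 := by
    rw [Matrix.det_fin_three]
    simp only [Matrix.of_apply, Matrix.cons_val', Matrix.cons_val]
    intro h
    have : (ω * b) * (ω - 1) = 0 := by linear_combination h
    exact mul_ne_zero (mul_ne_zero hω0 hb) (sub_ne_zero.2 hω1) this
  refine ProjEquiv.symm ⟨Matrix.GeneralLinearGroup.mkOfDetNeZero _ hdet, c⁻¹, ?_⟩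
  rw [← mul_assoc, ← C_mul, Units.inv_mul, C_1, one_mul]
  obtain ⟨h1, h2, h3, h4⟩ := omega_relations hK hω0 hω1 hb
  apply_fun C (σ := Fin 3) at h1 h2 h3 h4
  simp only [map_add, map_mul, map_pow, C_1, C_0, map_ofNat] at h1 h2 h3 h4
  change linearSubst !![1, 0, 0; 0, 1, ω * b; 0, 1, ω ^ 2 * b] _ = _
  simp only [linearSubst, map_add, map_mul, map_pow, bind₁_X_right, algHom_C,
    algebraMap_eq, Fin.sum_univ_three]
  simp
  linear_combination X 1 ^ 3 * h1 + C b * X 1 ^ 2 * X 2 * h2 + C b ^ 2 * X 1 * X 2 ^ 2 * h3 +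
    X 2 ^ 3 * h4

theorem projEquiv_diagonal_right (hK : Nat.card K = 4) {ω b : K} (hω0 : ω ≠ 0) (hω1 : ω ≠ 1)
    (hb : b ≠ 0) (c : Kˣ) :
    ProjEquiv (C (c : K) * (X 0 ^ 3 + X 1 ^ 3 + X 2 ^ 3 + C b * (X 1 * X 2 ^ 2)))
      (X 0 ^ 3 + C ω * X 1 ^ 3 + C (ω ^ 2) * X 2 ^ 3) := by
  have hdet : (!![1, 0, 0; 0, ω * b, 1; 0, ω ^ 2 * b, 1] : Matrix (Fin 3) (Fin 3) K).det ≠ 0 := by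
    rw [Matrix.det_fin_three]
    simp only [Matrix.of_apply, Matrix.cons_val', Matrix.cons_val]
    intro h
    have : (ω * b) * (ω - 1) = 0 := by linear_combination -h
    exact mul_ne_zero (mul_ne_zero hω0 hb) (sub_ne_zero.2 hω1) this
  refine ProjEquiv.symm ⟨Matrix.GeneralLinearGroup.mkOfDetNeZero _ hdet, c⁻¹, ?_⟩
  rw [← mul_assoc, ← C_mul, Units.inv_mul, C_1, one_mul]
  obtain ⟨h1, h2, h3, h4⟩ := omega_relations hK hω0 hω1 hb
  apply_fun C (σ := Fin 3) at h1 h2 h3 h4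
  simp only [map_add, map_mul, map_pow, C_1, C_0, map_ofNat] at h1 h2 h3 h4
  change linearSubst !![1, 0, 0; 0, ω * b, 1; 0, ω ^ 2 * b, 1] _ = _
  simp only [linearSubst, map_add, map_mul, map_pow, bind₁_X_right, algHom_C,
    algebraMap_eq, Fin.sum_univ_three]
  simp
  linear_combination X 2 ^ 3 * h1 + C b * X 2 ^ 2 * X 1 * h2 + C b ^ 2 * X 2 * X 1 ^ 2 * h3 +
    X 1 ^ 3 * h4

open Configuration in
theorem exists_frame (hK : Nat.card K = 4) {f : MvPolynomial (Fin 3) K} (hf : f.IsHomogeneous 3)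
    (hns : IsNonsingular f) (hN : (rationalPoints f).ncard = 9) :
    ∃ p q r : Projectivization K (Fin 3 → K), (frame p q r).det ≠ 0 ∧
      p ∉ rationalPoints f ∧ q ∉ rationalPoints f ∧ r ∉ rationalPoints f ∧
      (∀ s t : K, s ≠ 0 → t ≠ 0 → eval (s • p.rep + t • q.rep) f = 0) ∧
      (∀ s t : K, s ≠ 0 → t ≠ 0 → eval (s • p.rep + t • r.rep) f = 0) := by
  classical
  have : Finite K := Nat.finite_of_card_ne_zero (by omega)
  have := Fintype.ofFinite (Projectivization K (Fin 3 → K))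
  -- The order `n` satisfies `n² + n + 1 = 1 + 4 + 16`.
  have hord : ProjectivePlane.order (Projectivization K (Fin 3 → K))
      (Projectivization K (Fin 3 → K)) = 4 := by
    have h := ProjectivePlane.card_points (Projectivization K (Fin 3 → K))
      (Projectivization K (Fin 3 → K))
    rw [← Nat.card_eq_fintype_card, Projectivization.card_of_finrank K (Fin 3 → K) (n := 3)
      (by simp), hK] at h
    simp [Finset.sum_range_succ] at h
    nlinarith
  obtain ⟨l, m, p, hlm, hl, hm, hpl, hpm, hp⟩ :=
    ProjectivePlane.exists_trisecants_meeting_outside hord _ hN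
      (ncard_rationalPoints_inter_line_le hf hns)
  obtain ⟨q, hql, hqp, hq, hlS⟩ := ProjectivePlane.exists_remaining_point hord _ hl hpl hp
  obtain ⟨r, hrm, hrp, hr, hmS⟩ := ProjectivePlane.exists_remaining_point hord _ hm hpm hp
  have hrl : r ∉ l := fun h =>
    (Nondegenerate.eq_or_eq hpl h hpm hrm).elim (fun h => hrp h.symm) hlm
  refine ⟨p, q, r, det_frame_ne_zero hqp.symm hpl hql hrl, hp, hq, hr, fun s t hs ht => ?_,
    fun s t hs ht => ?_⟩
  · obtain ⟨h, h1, h2, h3⟩ := mk_smul_add_smul hqp.symm hpl hql hs ht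
    exact (mk_mem_rationalPoints hf _ h).1 (hlS _ h1 h2 h3)
  · obtain ⟨h, h1, h2, h3⟩ := mk_smul_add_smul hrp.symm hpm hrm hs ht
    exact (mk_mem_rationalPoints hf _ h).1 (hmS _ h1 h2 h3)

theorem exists_linearSubst_eq (hK : Nat.card K = 4) {ω : K} (hω0 : ω ≠ 0) (hω1 : ω ≠ 1)
    {f : MvPolynomial (Fin 3) K} (hf : f.IsHomogeneous 3)
    (hns : IsNonsingular f) (hN : (rationalPoints f).ncard = 9) :
    ∃ (M : Matrix.GeneralLinearGroup (Fin 3) K) (a : Kˣ) (b c d : K), linearSubst M.val f =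
      C (a : K) * (X 0 ^ 3 + X 1 ^ 3 + X 2 ^ 3 + C b * (X 1 ^ 2 * X 2) + C c * (X 1 * X 2 ^ 2) +
        C d * (X 0 * X 1 * X 2)) := by
  obtain ⟨p, q, r, hdet, hp, hq, hr, hpq, hpr⟩ := exists_frame hK hf hns hN
  let M := Matrix.GeneralLinearGroup.mkOfDetNeZero _ hdet
  obtain ⟨a₀, a₁, a₂, b₀₁, b₁₀, b₀₂, b₂₀, b₁₂, b₂₁, d, hf'⟩ :=
    exists_cubic_coeffs (isHomogeneous_linearSubst M.val hf)
  have two := FieldFour.two_eq_zero hK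
  have hev : ∀ v : Fin 3 → K, eval (v 0 • p.rep + v 1 • q.rep + v 2 • r.rep) f =
      eval v (linearSubst M.val f) := fun v => by
    rw [eval_linearSubst]
    change _ = eval ((frame p q r).mulVec _) f
    rw [frame_mulVec]
  rw [hf'] at hev
  have ha₀ : a₀ ≠ 0 := fun h => hp <| by
    change eval p.rep f = 0
    simpa [h] using hev ![1, 0, 0]
  -- Since `t³ = 1`, the cubic at `(1, t, 0)` reduces to a quadratic in `t` with constant term `a₀ +
  -- a₁`, vanishing at all three nonzero `t`.
  have h1 : a₀ + a₁ = 0 ∧ b₀₁ = 0 ∧ b₁₀ = 0 := by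
    refine eq_zero_of_quadratic hK hω0 hω1 fun t ht => ?_
    have h := hev ![1, t, 0]
    simp at h
    have h' := hpq 1 t one_ne_zero ht
    rw [one_smul] at h'
    rw [h', FieldFour.pow_three hK ht] at h
    linear_combination -h
  have h2 : a₀ + a₂ = 0 ∧ b₀₂ = 0 ∧ b₂₀ = 0 := by
    refine eq_zero_of_quadratic hK hω0 hω1 fun t ht => ?_
    have h := hev ![1, 0, t]
    simp at h
    have h' := hpr 1 t one_ne_zero ht
    rw [one_smul] at h'
    rw [h', FieldFour.pow_three hK ht] at h
    linear_combination -h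
  obtain ⟨h1, rfl, rfl⟩ := h1
  obtain ⟨h2, rfl, rfl⟩ := h2
  obtain rfl : a₁ = a₀ := by linear_combination h1 - a₀ * two
  obtain rfl : a₂ = a₁ := by linear_combination h2 - a₁ * two
  refine ⟨M, Units.mk0 _ ha₀, a₂⁻¹ * b₁₂, a₂⁻¹ * b₂₁, a₂⁻¹ * d, ?_⟩
  have hinv : C a₂ * C a₂⁻¹ = (1 : MvPolynomial (Fin 3) K) := by
    rw [← C_mul, mul_inv_cancel₀ ha₀, C_1]
  rw [hf']
  simp only [Units.val_mk0, C_0, C_mul]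
  linear_combination -(C b₁₂ * (X 1 ^ 2 * X 2) + C b₂₁ * (X 1 * X 2 ^ 2) +
    C d * (X 0 * X 1 * X 2)) * hinv

theorem isHermitianCurve_or_projEquiv (hK : Nat.card K = 4) {ω : K} (hω0 : ω ≠ 0) (hω1 : ω ≠ 1)
    {f : MvPolynomial (Fin 3) K} (hf : f.IsHomogeneous 3)
    (hns : IsNonsingular f) (hN : (rationalPoints f).ncard = 9) :
    IsHermitianCurve 2 f ∨ ProjEquiv f (X 0 ^ 3 + C ω * X 1 ^ 3 + C (ω ^ 2) * X 2 ^ 3) := by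
  obtain ⟨M, a, b, c, d, h⟩ := exists_linearSubst_eq hK hω0 hω1 hf hns hN
  have hcount : Nat.card {v : Fin 3 → K // v 0 ^ 3 + v 1 ^ 3 + v 2 ^ 3 + b * (v 1 ^ 2 * v 2) +
      c * (v 1 * v 2 ^ 2) + d * (v 0 * v 1 * v 2) = 0} = 28 := by
    rw [← card_zeros hK hf hN]
    let e : (Fin 3 → K) ≃ (Fin 3 → K) :=
      { toFun := M.val.mulVec
        invFun := (M⁻¹).val.mulVec
        left_inv := fun v => by
          rw [Matrix.mulVec_mulVec, ← Units.val_mul, inv_mul_cancel, Units.val_one,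
            Matrix.one_mulVec]
        right_inv := fun v => by
          rw [Matrix.mulVec_mulVec, ← Units.val_mul, mul_inv_cancel, Units.val_one,
            Matrix.one_mulVec] }
    refine Nat.card_congr (e.subtypeEquiv fun v => ?_)
    change _ ↔ eval (M.val.mulVec v) f = 0
    rw [← eval_linearSubst, h]
    simp
  obtain ⟨rfl, hbc⟩ := FieldFour.cubic_count hK hcount
  rw [C_0, zero_mul, add_zero] at h
  by_cases hb : b = 0
  · subst hb
    rw [C_0, zero_mul, add_zero] at h
    by_cases hc : c = 0
    · subst hc
      rw [C_0, zero_mul, add_zero] at h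
      left
      rw [← linearSubst_inv_linearSubst M f, h]
      exact (isHermitianCurve_fermat a).linearSubst_two hK M⁻¹
    · right
      refine ProjEquiv.of_linearSubst M ?_
      rw [h]
      exact projEquiv_diagonal_right hK hω0 hω1 hc a
  · obtain rfl := hbc.resolve_left hb
    rw [C_0, zero_mul, add_zero] at h
    right
    refine ProjEquiv.of_linearSubst M ?_
    rw [h]
    exact projEquiv_diagonal_left hK hω0 hω1 hb a

end PlaneCurve

theorem mainTheorem2 {K : Type*} [Field K] (hK : Nat.card K = 4)
    (ω : K) (hω0 : ω ≠ 0) (hω1 : ω ≠ 1)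
    (f : MvPolynomial (Fin 3) K) (hf : f.IsHomogeneous 3)
    (hns : PlaneCurve.IsNonsingular f)
    (hN : (PlaneCurve.rationalPoints f).ncard = 9) :
    (PlaneCurve.IsHermitianCurve 2 f ∨
      PlaneCurve.ProjEquiv f (X 0 ^ 3 + C ω * X 1 ^ 3 + C (ω ^ 2) * X 2 ^ 3)) ∧
    ¬ (PlaneCurve.IsHermitianCurve 2 f ∧
      PlaneCurve.ProjEquiv f (X 0 ^ 3 + C ω * X 1 ^ 3 + C (ω ^ 2) * X 2 ^ 3)) :=
  ⟨PlaneCurve.isHermitianCurve_or_projEquiv hK hω0 hω1 hf hns hN,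
    fun h => PlaneCurve.not_isHermitianCurve_of_projEquiv hK hω0 hω1 h.2 h.1⟩
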